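/- Let $S$ be a group or a (non-empty) inverse semigroup (a semigroup in which every $a$ has a unique $b$ with $aba=a$ and $bab=b$). Let $X$ be a finite choice of generators for $S$, that is, a finite set $X$ together with a surjective morphism $w \mapsto \overline{w}$ onto $S$ from the free semigroup $X^+$ or, if $S$ is a monoid, from the free monoid $X^*$; no symmetry of the generators is assumed. For $n \ge 1$ let $$\gamma(n) = \bigl|\{(u,v) \in X^+\times X^+ : |uv| = n,\ \overline{u}=\overline{v}\}\bigr| .$$ If $S$ has maximal global cogrowth with respect to $X$, that is, if $$\limsup_{n\to\infty} \gamma(n)^{1/n} = |X| ,$$ then $S$ is amenable: there is a mean $m$ on $\ell_\infty(S)$ (a positive linear functional with $m(1)=1$) that is left invariant, i.e. $m(s \mapsto f(as)) = m(f)$ for all $a \in S$ and $f \in \ell_\infty(S)$, and there is a mean on $\ell_\infty(S)$ that is right invariant, i.e. $m(s \mapsto f(sa)) = m(f)$ for all $a\in S$ and $f \in \ell_\infty(S)$. -/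

import Mathlib

open scoped ENNReal

/-- An inverse semigroup: every element `a` has a unique inverse, that is, a unique `b` with
`a * b * a = a` and `b * a * b = b`. -/
def IsInverseSemigroup (S : Type*) [Semigroup S] : Prop :=
  ∀ a : S, ∃! b : S, a * b * a = a ∧ b * a * b = b

namespace Cogrowth

/-- The global cogrowth function of a semigroup `S` with respect to a morphism `φ` from the free
semigroup `X⁺` to `S`: the number of pairs `(u, v)` of non-empty words with `|uv| = n` that
represent the same element of `S`. -/
noncomputable def globalCogrowth {X S : Type*} [Semigroup S] (φ : FreeSemigroup X →ₙ* S)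
    (n : ℕ) : ℕ :=
  Nat.card {p : FreeSemigroup X × FreeSemigroup X // (p.1 * p.2).length = n ∧ φ p.1 = φ p.2}

/-- The global cogrowth rate: the limit superior of the `n`-th roots of the global cogrowth
function. For finite `X` these roots form a bounded sequence of non-negative reals. -/
noncomputable def globalCogrowthRate {X S : Type*} [Semigroup S] (φ : FreeSemigroup X →ₙ* S) : ℝ :=
  Filter.limsup (fun n : ℕ => (globalCogrowth φ n : ℝ) ^ (1 / (n : ℝ))) Filter.atTop

/-- Maximal global cogrowth: the global cogrowth rate equals the number of generators. -/
def HasMaximalGlobalCogrowth {X S : Type*} [Semigroup S] (φ : FreeSemigroup X →ₙ* S) : Prop :=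
  globalCogrowthRate φ = Nat.card X

/-- The restriction to non-empty words of a morphism from the free monoid `X*` to a monoid. -/
def restrictNonempty {X M : Type*} [Monoid M] (ψ : FreeMonoid X →* M) : FreeSemigroup X →ₙ* M :=
  FreeSemigroup.lift fun x => ψ (FreeMonoid.of x)

/-- The Banach space `ℓ∞(S)` of bounded real functions on `S`. -/
abbrev LInfty (S : Type*) : Type _ := lp (fun _ : S => ℝ) ∞

/-- Precomposition of a bounded function with a self-map of `S`. -/
def LInfty.comp {S : Type*} (f : LInfty S) (g : S → S) : LInfty S :=
  ⟨fun s => f (g s), memℓp_infty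
    ⟨‖f‖, by rintro _ ⟨s, rfl⟩; exact lp.norm_apply_le_norm ENNReal.top_ne_zero f (g s)⟩⟩

/-- A mean on `ℓ∞(S)`: an element of the dual space that is positive and normalised. -/
def IsMean {S : Type*} (m : StrongDual ℝ (LInfty S)) : Prop :=
  m 1 = 1 ∧ ∀ f : LInfty S, (∀ s, 0 ≤ f s) → 0 ≤ m f

/-- Left amenability: there is a mean `m` with `m (s ↦ f (a * s)) = m f` for all `a` and `f`. -/
def LeftAmenable (S : Type*) [Semigroup S] : Prop :=
  ∃ m : StrongDual ℝ (LInfty S), IsMean m ∧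
    ∀ (a : S) (f : LInfty S), m (f.comp fun s => a * s) = m f

/-- Right amenability: there is a mean `m` with `m (s ↦ f (s * a)) = m f` for all `a` and `f`. -/
def RightAmenable (S : Type*) [Semigroup S] : Prop :=
  ∃ m : StrongDual ℝ (LInfty S), IsMean m ∧
    ∀ (a : S) (f : LInfty S), m (f.comp fun s => s * a) = m f

/-- Amenability; for groups and inverse semigroups the two conditions are equivalent. -/
def Amenable (S : Type*) [Semigroup S] : Prop :=
  LeftAmenable S ∧ RightAmenable S

end Cogrowth

/-! Every group is an inverse semigroup, so one argument covers all cases. It takes place in the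
maximal group image `G` of `S`. Words equal in `S` are equal in `G`, so the cogrowth is bounded by
the sums over `i` of ⟨v_i, v_(n-i)⟩, where v_k in ℓ²(G) is the sum of the point masses at the values
of all words of length k (`globalCogrowth_le`). Maximality forbids exponential decay of these sums
relative to |X|^n.

Now v_(k+j) is the sum of |X|^k left translates of v_j, all of the same norm. If each v_(k+j) were
shorter than |X|^k ‖v_j‖ by a fixed factor, decay would follow; so for suitable j the triangle
inequality is nearly sharp (`exists_norm_wordVec_add_ge`) and the translates are almost parallel
(`inner_wordVec_ge`). The normalised square of v_j is then a probability measure moved almost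
equally by any two words of equal length at most k. Averaging over powers of one generator removes
the equal-length condition (`approxInvariant_of_not_decay`).

Finitely many relations in `G` hold in `S` after right multiplication by one idempotent, so the
measures lift (`ApproxInvariant.lift`). A weak-* limit is a left invariant mean, and inversion in
`S` supplies the right invariant one. -/

namespace Cogrowth

/-! ### Inverse semigroups and the maximal group image. -/

section InverseSemigroup

variable {S : Type*} [Semigroup S]

theorem isInverseSemigroup_of_group (G : Type*) [Group G] : IsInverseSemigroup G := by
  intro a
  refine ⟨a⁻¹, by simp, ?_⟩
  rintro b ⟨h, -⟩
  have : a * b = 1 := by simpa using congrArg (· * a⁻¹) h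
  exact eq_inv_of_mul_eq_one_right this

theorem mul_eq_of_idempotent (hS : IsInverseSemigroup S) {e f : S} (he : e * e = e)
    (hf : f * f = f) : (e * f) * (e * f) = e * f := by
  obtain ⟨x, ⟨h1, h2⟩, hu⟩ := hS (e * f)
  -- Sandwiching the inverse `x` of `e * f` gives another inverse, hence `x` itself; this makes `x`
  -- idempotent, so that `x` and `e * f` are both inverses of `x`.
  have hx : f * x * e = x := by
    refine hu _ ⟨?_, ?_⟩
    · calc e * f * (f * x * e) * (e * f) = e * (f * f) * x * (e * e) * f := by
            simp only [mul_assoc]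
        _ = e * f := by rw [he, hf]; simpa only [mul_assoc] using h1
    · calc f * x * e * (e * f) * (f * x * e) = f * (x * ((e * e) * (f * f)) * x) * e := by
            simp only [mul_assoc]
        _ = f * x * e := by rw [he, hf, h2]
  have hxx : x * x = x := by
    calc x * x = (f * x * e) * (f * x * e) := by rw [hx]
      _ = f * (x * (e * f) * x) * e := by simp only [mul_assoc]
      _ = x := by rw [h2, hx]
  have h3 : e * f = x :=
    (hS x).unique ⟨h2, h1⟩ ⟨by rw [hxx, hxx], by rw [hxx, hxx]⟩
  rw [h3, hxx]

/-- Both products are idempotent, and both are inverses of `e * f`, so uniqueness identifies them.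
-/
theorem idempotents_commute (hS : IsInverseSemigroup S) {e f : S} (he : e * e = e)
    (hf : f * f = f) : e * f = f * e := by
  have h1 := mul_eq_of_idempotent hS he hf
  have h2 := mul_eq_of_idempotent hS hf he
  refine (hS (e * f)).unique ⟨by rw [h1, h1], by rw [h1, h1]⟩ ⟨?_, ?_⟩
  · calc e * f * (f * e) * (e * f) = e * (f * f) * (e * e) * f := by simp only [mul_assoc]
      _ = (e * f) * (e * f) := by rw [he, hf]; simp only [mul_assoc]
      _ = e * f := h1
  · calc f * e * (e * f) * (f * e) = f * (e * e) * (f * f) * e := by simp only [mul_assoc]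
      _ = (f * e) * (f * e) := by rw [he, hf]; simp only [mul_assoc]
      _ = f * e := h2

/-- The inverse of an element of an inverse semigroup. -/
noncomputable def sinv (hS : IsInverseSemigroup S) (a : S) : S := (hS a).choose

theorem mul_sinv_mul (hS : IsInverseSemigroup S) (a : S) : a * sinv hS a * a = a :=
  (hS a).choose_spec.1.1

theorem sinv_mul_sinv (hS : IsInverseSemigroup S) (a : S) :
    sinv hS a * a * sinv hS a = sinv hS a :=
  (hS a).choose_spec.1.2

theorem sinv_eq (hS : IsInverseSemigroup S) {a b : S} (h1 : a * b * a = a) (h2 : b * a * b = b) :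
    sinv hS a = b :=
  ((hS a).choose_spec.2 b ⟨h1, h2⟩).symm

theorem sinv_sinv (hS : IsInverseSemigroup S) (a : S) : sinv hS (sinv hS a) = a :=
  sinv_eq hS (sinv_mul_sinv hS a) (mul_sinv_mul hS a)

theorem mul_sinv_idem (hS : IsInverseSemigroup S) (a : S) :
    (a * sinv hS a) * (a * sinv hS a) = a * sinv hS a := by
  rw [← mul_assoc, mul_sinv_mul]

theorem sinv_mul_idem (hS : IsInverseSemigroup S) (a : S) :
    (sinv hS a * a) * (sinv hS a * a) = sinv hS a * a := by
  rw [← mul_assoc, sinv_mul_sinv]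

theorem sinv_mul_rev (hS : IsInverseSemigroup S) (a b : S) :
    sinv hS (a * b) = sinv hS b * sinv hS a := by
  have hc := idempotents_commute hS (sinv_mul_idem hS a) (mul_sinv_idem hS b)
  refine sinv_eq hS ?_ ?_
  · calc a * b * (sinv hS b * sinv hS a) * (a * b)
        = a * ((b * sinv hS b) * (sinv hS a * a)) * b := by simp only [mul_assoc]
      _ = (a * sinv hS a * a) * (b * sinv hS b * b) := by rw [← hc]; simp only [mul_assoc]
      _ = a * b := by rw [mul_sinv_mul, mul_sinv_mul]
  · calc sinv hS b * sinv hS a * (a * b) * (sinv hS b * sinv hS a)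
        = sinv hS b * ((sinv hS a * a) * (b * sinv hS b)) * sinv hS a := by
          simp only [mul_assoc]
      _ = (sinv hS b * b * sinv hS b) * (sinv hS a * a * sinv hS a) := by
          rw [hc]; simp only [mul_assoc]
      _ = sinv hS b * sinv hS a := by rw [sinv_mul_sinv, sinv_mul_sinv]

/-- An idempotent can be moved from the left of `a` to the right of `a`. -/
theorem exists_idempotent_mul_eq (hS : IsInverseSemigroup S) {f : S} (hf : f * f = f) (a : S) :
    ∃ g, g * g = g ∧ a * g = f * a := by
  have hc := idempotents_commute hS (mul_sinv_idem hS a) hf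
  have h : a * (sinv hS a * f * a) = f * a := by
    calc a * (sinv hS a * f * a) = (a * sinv hS a) * f * a := by simp only [mul_assoc]
      _ = f * (a * sinv hS a * a) := by rw [hc]; simp only [mul_assoc]
      _ = f * a := by rw [mul_sinv_mul]
  refine ⟨sinv hS a * f * a, ?_, h⟩
  calc sinv hS a * f * a * (sinv hS a * f * a)
      = sinv hS a * f * (a * (sinv hS a * f * a)) := by simp only [mul_assoc]
    _ = sinv hS a * (f * f) * a := by rw [h]; simp only [mul_assoc]
    _ = sinv hS a * f * a := by rw [hf]

/-- The minimum group congruence of an inverse semigroup. -/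
def minGroupCon (hS : IsInverseSemigroup S) [Nonempty S] : Con S where
  r a b := ∃ f, f * f = f ∧ a * f = b * f
  iseqv := by
    refine ⟨fun a => ?_, ?_, ?_⟩
    · exact ⟨_, mul_sinv_idem hS a, rfl⟩
    · rintro a b ⟨f, hf, h⟩
      exact ⟨f, hf, h.symm⟩
    · rintro a b c ⟨f, hf, h⟩ ⟨g, hg, h'⟩
      refine ⟨f * g, mul_eq_of_idempotent hS hf hg, ?_⟩
      rw [← mul_assoc, h, mul_assoc, idempotents_commute hS hf hg, ← mul_assoc, h', mul_assoc]
  mul' := by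
    rintro a b c d ⟨f, hf, h⟩ ⟨g, hg, h'⟩
    obtain ⟨k, hk, hck⟩ := exists_idempotent_mul_eq hS hf c
    obtain ⟨l, hl, hdl⟩ := exists_idempotent_mul_eq hS hf d
    have hgk : c * (g * k) = d * (g * k) := by rw [← mul_assoc, h', mul_assoc]
    have e1 : a * c * k = b * c * k := by
      rw [mul_assoc, mul_assoc, hck, ← mul_assoc, ← mul_assoc, h]
    refine ⟨g * k, mul_eq_of_idempotent hS hg hk, ?_⟩
    calc a * c * (g * k) = a * c * k * g := by
          rw [idempotents_commute hS hg hk]; simp only [mul_assoc]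
      _ = b * (c * (g * k)) := by
          rw [e1, idempotents_commute hS hg hk]; simp only [mul_assoc]
      _ = b * d * (g * k) := by rw [hgk]; simp only [mul_assoc]

theorem minGroupCon_idempotent_mul (hS : IsInverseSemigroup S) [Nonempty S] {e : S}
    (he : e * e = e) (a : S) : minGroupCon hS (e * a) a := by
  obtain ⟨g, hg, h⟩ := exists_idempotent_mul_eq hS he a
  refine ⟨g, hg, ?_⟩
  rw [mul_assoc, h, ← mul_assoc, he]

theorem minGroupCon_idempotents (hS : IsInverseSemigroup S) [Nonempty S] {e f : S}
    (he : e * e = e) (hf : f * f = f) : minGroupCon hS e f := by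
  refine ⟨e * f, mul_eq_of_idempotent hS he hf, ?_⟩
  rw [← mul_assoc, he, idempotents_commute hS he hf, ← mul_assoc, hf]

/-- The maximal group image of an inverse semigroup. -/
abbrev MaxGroupImage (hS : IsInverseSemigroup S) [Nonempty S] : Type _ := (minGroupCon hS).Quotient

noncomputable instance (hS : IsInverseSemigroup S) [Nonempty S] : Group (MaxGroupImage hS) :=
  -- Any idempotent would do: all of them are congruent and form the identity class.
  let e : S := Classical.arbitrary S * sinv hS (Classical.arbitrary S)
  have he : e * e = e := mul_sinv_idem hS _
  letI : One (MaxGroupImage hS) := ⟨(e : (minGroupCon hS).Quotient)⟩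
  letI : Inv (MaxGroupImage hS) :=
    ⟨fun q => ((sinv hS (Quotient.out q) : S) : (minGroupCon hS).Quotient)⟩
  Group.ofLeftAxioms mul_assoc
    (fun q => Con.induction_on q fun a =>
      (Con.eq _).2 (minGroupCon_idempotent_mul hS he a))
    (fun q => by
      have h : ((Quotient.out q : S) : (minGroupCon hS).Quotient) = q := Quotient.out_eq q
      calc q⁻¹ * q = q⁻¹ * ((Quotient.out q : S) : (minGroupCon hS).Quotient) := by rw [h]
        _ = 1 := (Con.eq _).2 (minGroupCon_idempotents hS (sinv_mul_idem hS _) he))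

/-- Finitely many pairs of elements with the same images in the maximal group image are equalised
by a single idempotent. -/
theorem exists_equalising_idempotent (hS : IsInverseSemigroup S) [Nonempty S] {ι : Type*}
    (t : Finset ι) (a b : ι → S) (h : ∀ i ∈ t, minGroupCon hS (a i) (b i)) :
    ∃ e, e * e = e ∧ ∀ i ∈ t, a i * e = b i * e := by
  classical
  induction t using Finset.induction_on with
  | empty => exact ⟨_, mul_sinv_idem hS (Classical.arbitrary S), by simp⟩
  | insert i t hi ih =>
    obtain ⟨e, he, het⟩ := ih fun j hj => h j (Finset.mem_insert_of_mem hj)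
    obtain ⟨f, hf, hfi⟩ := h i (Finset.mem_insert_self i t)
    refine ⟨f * e, mul_eq_of_idempotent hS hf he, fun j hj => ?_⟩
    rcases Finset.mem_insert.1 hj with rfl | hj
    · rw [← mul_assoc, hfi, mul_assoc]
    · rw [idempotents_commute hS hf he, ← mul_assoc, het j hj, mul_assoc]

end InverseSemigroup

/-! ### Means as weak-* limits of finitely supported measures. -/

section Means

/-- The functional on `ℓ∞(S)` given by a finite family of weighted points. -/
noncomputable def weightedSum {S ι : Type*} [Fintype ι] (p : ι → ℝ) (s : ι → S) :
    StrongDual ℝ (LInfty S) :=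
  LinearMap.mkContinuous
    { toFun := fun f => ∑ i, p i * f (s i)
      map_add' := fun f g => by simp [mul_add, Finset.sum_add_distrib]
      map_smul' := fun c f => by
        simp only [lp.coeFn_smul, Pi.smul_apply, smul_eq_mul, RingHom.id_apply, Finset.mul_sum]
        exact Finset.sum_congr rfl fun i _ => by ring }
    (∑ i, |p i|) fun f => by
      simp only [LinearMap.coe_mk, AddHom.coe_mk, Real.norm_eq_abs, Finset.sum_mul]
      refine (Finset.abs_sum_le_sum_abs _ _).trans (Finset.sum_le_sum fun i _ => ?_)
      rw [abs_mul]
      exact mul_le_mul_of_nonneg_left (lp.norm_apply_le_norm ENNReal.top_ne_zero f (s i))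
        (abs_nonneg _)

theorem norm_weightedSum_le {S ι : Type*} [Fintype ι] (p : ι → ℝ) (s : ι → S) :
    ‖weightedSum p s‖ ≤ ∑ i, |p i| :=
  LinearMap.mkContinuous_norm_le _ (Finset.sum_nonneg fun i _ => abs_nonneg (p i)) _

/-- Approximate invariance of finitely supported probability measures on `S` under a family of
self-maps. -/
def ApproxInvariant.{u, v} {S : Type u} {Y : Type v} (τ : Y → S → S) : Prop :=
  ∀ ε : ℝ, 0 < ε → ∃ (ι : Type u) (_ : Fintype ι) (p : ι → ℝ) (s : ι → S),
    (∀ i, 0 ≤ p i) ∧ ∑ i, p i = 1 ∧ ∀ (y : Y) (f : S → ℝ) (C : ℝ), (∀ t, |f t| ≤ C) →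
      |∑ i, p i * f (τ y (s i)) - ∑ i, p i * f (s i)| ≤ ε * C

theorem ApproxInvariant.exists_mean {S Y : Type*} {τ : Y → S → S} (h : ApproxInvariant τ) :
    ∃ m : StrongDual ℝ (LInfty S), IsMean m ∧ ∀ (y : Y) (f : LInfty S), m (f.comp (τ y)) = m f := by
  choose ι hι p s hp hp1 hinv using fun n : ℕ =>
    h (1 / ((n : ℝ) + 1)) (by positivity)
  let M : ℕ → WeakDual ℝ (LInfty S) := fun n =>
    StrongDual.toWeakDual (weightedSum (p n) (s n))
  have hM : ∀ n f, M n f = ∑ i, p n i * f (s n i) := fun n f => rfl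
  have hball : ∀ n, M n ∈ WeakDual.toStrongDual ⁻¹' Metric.closedBall
      (0 : StrongDual ℝ (LInfty S)) 1 := by
    intro n
    simp only [Set.mem_preimage, mem_closedBall_zero_iff]
    refine (norm_weightedSum_le (p n) (s n)).trans ?_
    rw [← hp1 n]
    exact (Finset.sum_congr rfl fun i _ => abs_of_nonneg (hp n i)).le
  -- Banach–Alaoglu: a limit along a nonprincipal ultrafilter needs no subsequence, so `S` may be of
  -- any size.
  obtain ⟨m, -, hm⟩ := (WeakDual.isCompact_closedBall (0 : StrongDual ℝ (LInfty S)) 1)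
    |>.ultrafilter_le_nhds ((Filter.hyperfilter ℕ).map M)
      (by
        rw [Filter.le_principal_iff]
        exact Filter.mem_map.2 (Filter.univ_mem' hball))
  have hlim : ∀ f : LInfty S,
      Filter.Tendsto (fun n => M n f) (Filter.hyperfilter ℕ : Filter ℕ) (nhds (m f)) := by
    intro f
    have h1 : Filter.Tendsto M (Filter.hyperfilter ℕ : Filter ℕ) (nhds m) := hm
    exact ((WeakDual.eval_continuous f).tendsto m).comp h1
  refine ⟨WeakDual.toStrongDual m, ⟨?_, ?_⟩, ?_⟩
  · refine tendsto_nhds_unique (hlim 1) ?_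
    have : ∀ n, M n 1 = 1 := fun n => by
      rw [hM, ← hp1 n]
      exact Finset.sum_congr rfl fun i _ => by
        rw [show ((1 : LInfty S) : S → ℝ) = 1 from rfl]; simp
    simp only [this]
    exact tendsto_const_nhds
  · intro f hf
    exact ge_of_tendsto' (hlim f) fun n => Finset.sum_nonneg fun i _ => mul_nonneg (hp n i) (hf _)
  · intro y f
    have h0 : Filter.Tendsto (fun n => M n (f.comp (τ y)) - M n f)
        (Filter.hyperfilter ℕ : Filter ℕ) (nhds 0) := by
      have hz : Filter.Tendsto (fun n : ℕ => 1 / ((n : ℝ) + 1) * ‖f‖) Filter.atTop (nhds 0) := by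
        simpa using (tendsto_one_div_add_atTop_nhds_zero_nat (𝕜 := ℝ)).mul_const ‖f‖
      refine squeeze_zero_norm (fun n => ?_)
        (hz.mono_left (by rw [← Nat.cofinite_eq_atTop]; exact Filter.hyperfilter_le_cofinite))
      exact hinv n y f ‖f‖ fun t => lp.norm_apply_le_norm ENNReal.top_ne_zero f t
    have h1 := tendsto_nhds_unique h0 ((hlim (f.comp (τ y))).sub (hlim f))
    exact (sub_eq_zero.1 h1.symm)

end Means

/-! ### From ℓ² vectors to densities. -/

section SquareSummable

variable {G : Type*}

theorem hasSum_sq (A : lp (fun _ : G => ℝ) 2) : HasSum (fun h => A h ^ 2) (‖A‖ ^ 2) := by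
  simpa [real_inner_self_eq_norm_sq] using lp.hasSum_inner (𝕜 := ℝ) A A

theorem summable_sq_mul (A : lp (fun _ : G => ℝ) 2) {F : G → ℝ} {C : ℝ} (hF : ∀ h, |F h| ≤ C) :
    Summable fun h => A h ^ 2 * F h := by
  refine Summable.of_norm_bounded ((hasSum_sq A).summable.mul_right C) fun h => ?_
  rw [norm_mul, Real.norm_eq_abs, Real.norm_eq_abs, abs_sq]
  exact mul_le_mul_of_nonneg_left (hF h) (sq_nonneg _)

/-- Pointwise, |A² - B²| = |A + B| |A - B|, which the weighted AM-GM inequality splits into squares.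
The weight `δ` is later matched to the size of ‖A - B‖. -/
theorem abs_tsum_sq_sub_le (A B : lp (fun _ : G => ℝ) 2) {F : G → ℝ} {C : ℝ}
    (hF : ∀ h, |F h| ≤ C) {δ : ℝ} (hδ : 0 < δ) :
    |∑' h, A h ^ 2 * F h - ∑' h, B h ^ 2 * F h| ≤
      (δ / 2 * ‖A + B‖ ^ 2 + 1 / (2 * δ) * ‖A - B‖ ^ 2) * C := by
  rw [← (summable_sq_mul A hF).tsum_sub (summable_sq_mul B hF)]
  have hs := (((hasSum_sq (A + B)).mul_left (δ / 2)).add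
    ((hasSum_sq (A - B)).mul_left (1 / (2 * δ)))).mul_right C
  refine tsum_of_norm_bounded (E := ℝ) hs fun h => ?_
  rw [← sub_mul, norm_mul, Real.norm_eq_abs, Real.norm_eq_abs, lp.coeFn_add, lp.coeFn_sub,
    Pi.add_apply, Pi.sub_apply]
  refine mul_le_mul ?_ (hF h) (abs_nonneg _) (by positivity)
  rw [sq_sub_sq, abs_mul, ← sq_abs (A h + B h), ← sq_abs (A h - B h)]
  set s := |A h + B h|
  set t := |A h - B h|
  have h1 : δ / 2 * s ^ 2 + 1 / (2 * δ) * t ^ 2 - s * t = (δ * s - t) ^ 2 / (2 * δ) := by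
    field_simp
    ring
  have h2 : 0 ≤ (δ * s - t) ^ 2 / (2 * δ) := by positivity
  linarith

end SquareSummable

/-- The value in `G` of a word. -/
def wordVal {X G : Type*} [Monoid G] (g : X → G) (u : List X) : G := (u.map g).prod

theorem wordVal_append {X G : Type*} [Monoid G] (g : X → G) (u v : List X) :
    wordVal g (u ++ v) = wordVal g u * wordVal g v := by
  simp [wordVal]

/-! ### Word vectors in ℓ²(G) and nearly sharp triangle inequalities. -/

section Words

variable {X G : Type*} [Finite X] [Group G]

/-- The finite set of words of length `k`. -/
noncomputable def words (X : Type*) [Finite X] (k : ℕ) : Finset (List X) :=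
  (List.finite_length_eq X k).toFinset

theorem mem_words {k : ℕ} {u : List X} : u ∈ words X k ↔ u.length = k := by
  simp [words]

theorem card_words (k : ℕ) : (words X k).card = Nat.card X ^ k := by
  have := Fintype.ofFinite X
  rw [Nat.card_eq_fintype_card, ← card_vector, words,
    ← Set.ncard_eq_toFinset_card _ (List.finite_length_eq X k), ← Nat.card_coe_set_eq,
    ← Nat.card_eq_fintype_card]
  rfl

theorem sum_words_add {M : Type*} [AddCommMonoid M] (f : List X → M) (k j : ℕ) :
    ∑ u ∈ words X (k + j), f u = ∑ w ∈ words X k, ∑ u ∈ words X j, f (w ++ u) := by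
  rw [← Finset.sum_product']
  symm
  refine Finset.sum_bij' (fun q _ => q.1 ++ q.2) (fun u _ => (u.take k, u.drop k)) ?_ ?_ ?_ ?_ ?_
  · rintro ⟨w, u⟩ h
    simp only [Finset.mem_product, mem_words] at h ⊢
    simp [h.1, h.2]
  · intro u h
    simp only [Finset.mem_product, mem_words] at h ⊢
    simp [h]
  · rintro ⟨w, u⟩ h
    simp only [Finset.mem_product, mem_words] at h
    simp [← h.1]
  · intro u h
    simp
  · intro q h
    rfl

open Classical in
/-- The sum over the words `u` of length `k` of the basis vectors of `ℓ²(G)` at `a * u`. -/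
noncomputable def wordVec (g : X → G) (a : G) (k : ℕ) : lp (fun _ : G => ℝ) 2 :=
  ∑ u ∈ words X k, lp.single 2 (a * wordVal g u) (1 : ℝ)

open Classical in
theorem inner_wordVec (g : X → G) (a b : G) (k l : ℕ) :
    inner ℝ (wordVec g a k) (wordVec g b l) =
      ∑ u ∈ words X k, ∑ v ∈ words X l, if a * wordVal g u = b * wordVal g v then (1 : ℝ) else 0 := by
  simp only [wordVec, sum_inner, inner_sum, lp.inner_single_left, lp.single_apply, Pi.single_apply]
  rw [Finset.sum_comm]
  refine Finset.sum_congr rfl fun u _ => Finset.sum_congr rfl fun v _ => ?_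
  split_ifs <;> simp

/-- Left translation is an isometry of ℓ²(G). -/
theorem norm_wordVec (g : X → G) (a : G) (k : ℕ) : ‖wordVec g a k‖ = ‖wordVec g 1 k‖ := by
  classical
  rw [← sq_eq_sq₀ (norm_nonneg _) (norm_nonneg _), ← real_inner_self_eq_norm_sq,
    ← real_inner_self_eq_norm_sq, inner_wordVec, inner_wordVec]
  simp only [mul_right_inj]

open Classical in
theorem wordVec_apply (g : X → G) (a h : G) (k : ℕ) :
    wordVec g a k h = ∑ u ∈ words X k, if h = a * wordVal g u then (1 : ℝ) else 0 := by
  simp only [wordVec, lp.coeFn_sum, Finset.sum_apply, lp.single_apply, Pi.single_apply]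

theorem wordVec_apply_mul (g : X → G) (a h : G) (k : ℕ) :
    wordVec g a k (a * h) = wordVec g 1 k h := by
  classical
  simp only [wordVec_apply, mul_right_inj, one_mul]

theorem wordVec_add (g : X → G) (k j : ℕ) :
    wordVec g 1 (k + j) = ∑ w ∈ words X k, wordVec g (wordVal g w) j := by
  simp only [wordVec, sum_words_add, wordVal_append, one_mul]

theorem norm_wordVec_add_le (g : X → G) (k j : ℕ) :
    ‖wordVec g 1 (k + j)‖ ≤ (Nat.card X : ℝ) ^ k * ‖wordVec g 1 j‖ := by
  rw [wordVec_add]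
  refine (norm_sum_le _ _).trans ?_
  simp only [norm_wordVec, Finset.sum_const, card_words, nsmul_eq_mul, Nat.cast_pow, le_refl]

open Classical in
theorem norm_wordVec_zero (g : X → G) : ‖wordVec g 1 0‖ = 1 := by
  have h : words X 0 = {[]} := by ext u; simp [mem_words]
  rw [wordVec, h, Finset.sum_singleton, lp.norm_single (by norm_num)]
  simp

theorem norm_wordVec_le (g : X → G) (k : ℕ) : ‖wordVec g 1 k‖ ≤ (Nat.card X : ℝ) ^ k := by
  simpa [norm_wordVec_zero] using norm_wordVec_add_le g k 0

theorem norm_wordVec_pos [Nonempty X] (g : X → G) (k : ℕ) : 0 < ‖wordVec g 1 k‖ := by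
  classical
  obtain ⟨x⟩ := ‹Nonempty X›
  have hu : List.replicate k x ∈ words X k := mem_words.2 (by simp)
  have h1 : 1 ≤ wordVec g 1 k (1 * wordVal g (List.replicate k x)) := by
    rw [wordVec_apply]
    refine le_trans (by simp) (Finset.single_le_sum (f := fun u => if 1 * wordVal g (List.replicate k x) = 1 * wordVal g u then (1 : ℝ) else 0) (fun u _ => ?_) hu)
    positivity
  refine norm_pos_iff.2 fun h => ?_
  rw [h] at h1
  norm_num at h1

/-- If the correlations of the word vectors do not decay exponentially, then for every `k` there
are word vectors that are almost not contracted by `k` further steps. -/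
theorem exists_norm_wordVec_add_ge [Nonempty X] (g : X → G)
    (hdecay : ¬ ∃ ρ C : ℝ, 0 ≤ ρ ∧ ρ < Nat.card X ∧ 0 ≤ C ∧ ∀ n : ℕ,
      ∑ i ∈ Finset.range (n + 1), inner ℝ (wordVec g 1 i) (wordVec g 1 (n - i)) ≤
        C * (n + 1) * ρ ^ n) (k : ℕ) {ε : ℝ} (hε : 0 < ε) :
    ∃ j, (1 - ε) * (Nat.card X : ℝ) ^ k * ‖wordVec g 1 j‖ ≤ ‖wordVec g 1 (k + j)‖ := by
  by_contra! hcon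
  apply hdecay
  have hd : (0 : ℝ) < Nat.card X := by exact_mod_cast Nat.card_pos
  have hk : k ≠ 0 := by
    rintro rfl
    have := hcon 0
    simp only [pow_zero, mul_one, norm_wordVec_zero, add_zero] at this
    linarith
  have hε1 : 0 < 1 - ε := by
    by_contra! h
    have := (norm_nonneg _).trans_lt (hcon 0)
    rw [norm_wordVec_zero, mul_one] at this
    exact absurd this (not_lt.2 (mul_nonpos_of_nonpos_of_nonneg h (by positivity)))
  obtain ⟨r, hr0, hr1, hrk⟩ : ∃ r : ℝ, 0 < r ∧ r < 1 ∧ r ^ k = 1 - ε := by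
    refine ⟨(1 - ε) ^ (1 / (k : ℝ)), by positivity, ?_, ?_⟩
    · exact Real.rpow_lt_one hε1.le (by linarith) (by positivity)
    · rw [one_div, Real.rpow_inv_natCast_pow hε1.le hk]
  set d : ℝ := ((Nat.card X : ℕ) : ℝ)
  -- Each block of `k` steps gains a factor `r ^ k = 1 - ε`; the prefactor pays for an initial block
  -- shorter than `k`.
  have hbound : ∀ j, ‖wordVec g 1 j‖ ≤ (r ^ k)⁻¹ * (r * d) ^ j := by
    intro j
    induction j using Nat.strong_induction_on with
    | _ j ih =>
      rcases lt_or_ge j k with hj | hj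
      · refine (norm_wordVec_le g j).trans ?_
        rw [mul_pow, ← mul_assoc]
        refine le_mul_of_one_le_left (by positivity) ?_
        rw [inv_mul_eq_div, one_le_div (by positivity)]
        exact pow_le_pow_of_le_one hr0.le hr1.le hj.le
      · obtain ⟨i, rfl⟩ := Nat.exists_eq_add_of_le hj
        calc ‖wordVec g 1 (k + i)‖ ≤ (1 - ε) * d ^ k * ‖wordVec g 1 i‖ := (hcon i).le
          _ ≤ (1 - ε) * d ^ k * ((r ^ k)⁻¹ * (r * d) ^ i) := by
              gcongr
              exact ih i (by omega)
          _ = (r ^ k)⁻¹ * (r * d) ^ (k + i) := by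
              rw [← hrk, pow_add, mul_pow]; ring
  refine ⟨r * d, (r ^ k)⁻¹ ^ 2, by positivity, by nlinarith, by positivity, fun n => ?_⟩
  have : ∀ i ∈ Finset.range (n + 1), inner ℝ (wordVec g 1 i) (wordVec g 1 (n - i)) ≤
      (r ^ k)⁻¹ ^ 2 * (r * d) ^ n := by
    intro i hi
    have hin : i + (n - i) = n := by have := Finset.mem_range.1 hi; omega
    calc inner ℝ (wordVec g 1 i) (wordVec g 1 (n - i))
        ≤ ‖wordVec g 1 i‖ * ‖wordVec g 1 (n - i)‖ := real_inner_le_norm _ _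
      _ ≤ ((r ^ k)⁻¹ * (r * d) ^ i) * ((r ^ k)⁻¹ * (r * d) ^ (n - i)) := by
          gcongr <;> exact hbound _
      _ = (r ^ k)⁻¹ ^ 2 * (r * d) ^ (i + (n - i)) := by rw [pow_add]; ring
      _ = _ := by rw [hin]
  refine (Finset.sum_le_sum this).trans ?_
  rw [Finset.sum_const, Finset.card_range, nsmul_eq_mul]
  push_cast
  apply le_of_eq
  ring

/-- If word vectors are almost not contracted by `k` further steps, then their translates by words
of equal length at most `k` are almost parallel. -/
theorem inner_wordVec_ge [Nonempty X] (g : X → G) {k j : ℕ} {ε : ℝ} (hε : 0 ≤ ε) (hε1 : ε ≤ 1)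
    (h : (1 - ε) * (Nat.card X : ℝ) ^ k * ‖wordVec g 1 j‖ ≤ ‖wordVec g 1 (k + j)‖)
    {w w' : List X} (hw : w.length ≤ k) (hww : w'.length = w.length) :
    ‖wordVec g 1 j‖ ^ 2 - 2 * ε * (Nat.card X : ℝ) ^ (2 * k) * ‖wordVec g 1 j‖ ^ 2 ≤
      inner ℝ (wordVec g (wordVal g w) j) (wordVec g (wordVal g w') j) := by
  classical
  have hd : (1 : ℝ) ≤ Nat.card X := by exact_mod_cast Nat.card_pos
  set d : ℝ := ((Nat.card X : ℕ) : ℝ) with hdd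
  set i := w.length
  set V := ‖wordVec g 1 j‖ with hV
  have hV0 : 0 ≤ V := norm_nonneg _
  -- The remaining `k - i` steps stretch by at most `d ^ (k - i)`, so near-sharpness at `k` passes
  -- down to `i`.
  have h1 : (1 - ε) * d ^ i * V ≤ ‖wordVec g 1 (i + j)‖ := by
    have h2 := norm_wordVec_add_le g (k - i) (i + j)
    rw [← add_assoc, Nat.sub_add_cancel hw] at h2
    have h3 := h.trans h2
    have h4 : d ^ k = d ^ (k - i) * d ^ i := by rw [← pow_add, Nat.sub_add_cancel hw]
    refine le_of_mul_le_mul_left ?_ (show 0 < d ^ (k - i) by positivity)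
    calc d ^ (k - i) * ((1 - ε) * d ^ i * V) = (1 - ε) * d ^ k * V := by rw [h4]; ring
      _ ≤ _ := h3
  have h2 : ((1 - ε) * d ^ i * V) ^ 2 ≤ ‖wordVec g 1 (i + j)‖ ^ 2 := by
    have : 0 ≤ 1 - ε := by linarith
    gcongr
  let f : List X × List X → ℝ := fun q =>
    inner ℝ (wordVec g (wordVal g q.1) j) (wordVec g (wordVal g q.2) j)
  have hf : ∀ q, f q ≤ V ^ 2 := fun q => by
    refine (real_inner_le_norm _ _).trans ?_
    rw [norm_wordVec g (wordVal g q.1), norm_wordVec g (wordVal g q.2), sq]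
  have h3 : ‖wordVec g 1 (i + j)‖ ^ 2 = ∑ q ∈ words X i ×ˢ words X i, f q := by
    rw [← real_inner_self_eq_norm_sq, wordVec_add, Finset.sum_product]
    simp only [sum_inner, inner_sum, f]
    exact Finset.sum_comm
  have hmem : (w, w') ∈ words X i ×ˢ words X i := by
    simp [mem_words, hww, i]
  -- All other pairs contribute at most `V ^ 2`, so in the worst case this one pair carries the
  -- whole defect.
  have h4 : ∑ q ∈ words X i ×ˢ words X i, f q ≤ f (w, w') + (d ^ (2 * i) - 1) * V ^ 2 := by
    rw [← Finset.add_sum_erase _ _ hmem]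
    gcongr
    refine (Finset.sum_le_sum fun q _ => hf q).trans ?_
    rw [Finset.sum_const, Finset.card_erase_of_mem hmem, Finset.card_product, card_words,
      nsmul_eq_mul, Nat.cast_sub (Nat.mul_pos (pow_pos Nat.card_pos _) (pow_pos Nat.card_pos _))]
    push_cast
    rw [← hdd, two_mul, pow_add]
  have h5 : d ^ (2 * i) ≤ d ^ (2 * k) := pow_le_pow_right₀ hd (by omega)
  have h6 : ((1 - ε) * d ^ i * V) ^ 2 = (1 - ε) ^ 2 * (d ^ (2 * i) * V ^ 2) := by
    rw [two_mul, pow_add]; ring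
  have h7 : (1 - 2 * ε) * (d ^ (2 * i) * V ^ 2) ≤ (1 - ε) ^ 2 * (d ^ (2 * i) * V ^ 2) := by
    gcongr
    nlinarith
  have h8 : 2 * ε * d ^ (2 * i) * V ^ 2 ≤ 2 * ε * d ^ (2 * k) * V ^ 2 := by gcongr
  change _ ≤ f (w, w')
  nlinarith

open Classical in
theorem sum_sq_mul_eq_tsum (g : X → G) (a : G) (j : ℕ) (F : G → ℝ) :
    ∑ h ∈ (words X j).image (wordVal g), wordVec g 1 j h ^ 2 * F (a * h) =
      ∑' h, wordVec g a j h ^ 2 * F h := by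
  rw [← (Equiv.mulLeft a).tsum_eq, tsum_eq_sum]
  · simp only [Equiv.coe_mulLeft, wordVec_apply_mul]
    rfl
  · intro h hh
    have : wordVec g 1 j h = 0 := by
      rw [wordVec_apply]
      refine Finset.sum_eq_zero fun u hu => if_neg ?_
      rintro rfl
      exact hh (by rw [one_mul]; exact Finset.mem_image_of_mem _ hu)
    simp only [Equiv.coe_mulLeft, wordVec_apply_mul, this]
    ring

/-- Without exponential decay there are finitely supported probability measures that are almost
equally translated by all words of the same length, up to any given length. -/
theorem exists_almost_equally_translated [Nonempty X] (g : X → G)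
    (hdecay : ¬ ∃ ρ C : ℝ, 0 ≤ ρ ∧ ρ < Nat.card X ∧ 0 ≤ C ∧ ∀ n : ℕ,
      ∑ i ∈ Finset.range (n + 1), inner ℝ (wordVec g 1 i) (wordVec g 1 (n - i)) ≤
        C * (n + 1) * ρ ^ n) (k : ℕ) {δ : ℝ} (hδ : 0 < δ) (hδ1 : δ ≤ 1) :
    ∃ (T : Finset G) (p : G → ℝ), (∀ h, 0 ≤ p h) ∧ ∑ h ∈ T, p h = 1 ∧
      ∀ w w' : List X, w.length ≤ k → w'.length = w.length → ∀ (F : G → ℝ) (C : ℝ),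
        (∀ h, |F h| ≤ C) →
        |∑ h ∈ T, p h * F (wordVal g w * h) - ∑ h ∈ T, p h * F (wordVal g w' * h)| ≤
          4 * δ * C := by
  classical
  have hd : (1 : ℝ) ≤ Nat.card X := by exact_mod_cast Nat.card_pos
  set d : ℝ := ((Nat.card X : ℕ) : ℝ) with hdd
  -- The denominator cancels the factor `d ^ (2 * k)` lost in `inner_wordVec_ge`; the translates
  -- then differ by at most `2 * δ * V` in norm.
  have hε : 0 < δ ^ 2 / d ^ (2 * k) := by positivity
  have hε1 : δ ^ 2 / d ^ (2 * k) ≤ 1 :=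
    div_le_one_of_le₀ ((pow_le_one₀ hδ.le hδ1).trans (one_le_pow₀ hd)) (by positivity)
  obtain ⟨j, hj⟩ := exists_norm_wordVec_add_ge g hdecay k hε
  set V := ‖wordVec g 1 j‖ with hV
  have hV0 : 0 < V := norm_wordVec_pos g j
  have hsum := sum_sq_mul_eq_tsum g
  refine ⟨(words X j).image (wordVal g), fun h => wordVec g 1 j h ^ 2 / V ^ 2,
    fun h => by positivity, ?_, ?_⟩
  · have := hsum 1 j fun _ => 1
    simp only [mul_one, (hasSum_sq _).tsum_eq] at this
    rw [← Finset.sum_div, this, div_self (by positivity)]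
  · intro w w' hw hww F C hF
    have hin := inner_wordVec_ge g hε.le hε1 hj hw hww
    have hpull : ∀ a : G, ∑ h ∈ (words X j).image (wordVal g),
        wordVec g 1 j h ^ 2 / V ^ 2 * F (a * h) = (∑' h, wordVec g a j h ^ 2 * F h) / V ^ 2 := by
      intro a
      rw [← hsum, Finset.sum_div]
      exact Finset.sum_congr rfl fun _ _ => by ring
    rw [hpull, hpull, ← sub_div, abs_div, abs_of_pos (show 0 < V ^ 2 by positivity),
      div_le_iff₀ (by positivity)]
    refine (abs_tsum_sq_sub_le _ _ hF hδ).trans ?_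
    have hC : 0 ≤ C := (abs_nonneg _).trans (hF 1)
    have hp := norm_add_sq_real (wordVec g (wordVal g w) j) (wordVec g (wordVal g w') j)
    have hm := norm_sub_sq_real (wordVec g (wordVal g w) j) (wordVec g (wordVal g w') j)
    have hle := real_inner_le_norm (wordVec g (wordVal g w) j) (wordVec g (wordVal g w') j)
    rw [norm_wordVec g (wordVal g w), norm_wordVec g (wordVal g w'), ← hV] at hp hm hle
    have e1 : 2 * (δ ^ 2 / d ^ (2 * k)) * d ^ (2 * k) * V ^ 2 = 2 * δ ^ 2 * V ^ 2 := by
      field_simp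
    rw [← hdd, e1, ← hV] at hin
    have hp' : ‖wordVec g (wordVal g w) j + wordVec g (wordVal g w') j‖ ^ 2 ≤ 4 * V ^ 2 := by
      nlinarith
    have hm' : ‖wordVec g (wordVal g w) j - wordVec g (wordVal g w') j‖ ^ 2 ≤
        4 * δ ^ 2 * V ^ 2 := by
      nlinarith
    calc _ ≤ (δ / 2 * (4 * V ^ 2) + 1 / (2 * δ) * (4 * δ ^ 2 * V ^ 2)) * C := by gcongr
      _ = 4 * δ * C * V ^ 2 := by field_simp; ring

end Words

/-! ### The cogrowth rate and comparison with a group image. -/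

section Rate

variable {X S : Type*} [Semigroup S]

theorem HasMaximalGlobalCogrowth.not_exists_bound {φ : FreeSemigroup X →ₙ* S}
    (h : HasMaximalGlobalCogrowth φ) :
    ¬ ∃ ρ C : ℝ, 0 ≤ ρ ∧ ρ < Nat.card X ∧ 0 ≤ C ∧ ∀ n : ℕ,
      (globalCogrowth φ n : ℝ) ≤ C * (n + 1) * ρ ^ n := by
  rintro ⟨ρ, C, hρ, hρd, hC, hb⟩
  -- The gap between `ρ` and `σ` absorbs the factor `C * (n + 1)`.
  obtain ⟨σ, hρσ, hσd⟩ := exists_between hρd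
  have hσ : 0 < σ := hρ.trans_lt hρσ
  have hr0 : 0 ≤ ρ / σ := by positivity
  have hr1 : ρ / σ < 1 := (div_lt_one hσ).2 hρσ
  have hlim : Filter.Tendsto (fun n : ℕ => C * ((n : ℝ) * (ρ / σ) ^ n + (ρ / σ) ^ n))
      Filter.atTop (nhds 0) := by
    simpa using ((tendsto_self_mul_const_pow_of_lt_one hr0 hr1).add
      (tendsto_pow_atTop_nhds_zero_of_lt_one hr0 hr1)).const_mul C
  have hev : ∀ᶠ n : ℕ in Filter.atTop, (globalCogrowth φ n : ℝ) ^ (1 / (n : ℝ)) ≤ σ := by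
    filter_upwards [hlim.eventually_le_const one_pos, Filter.eventually_ne_atTop 0] with n hn hn0
    have h1 : (globalCogrowth φ n : ℝ) ≤ σ ^ n := by
      refine (hb n).trans ?_
      have : C * (n + 1) * ρ ^ n = C * ((n : ℝ) * (ρ / σ) ^ n + (ρ / σ) ^ n) * σ ^ n := by
        rw [div_pow]
        field_simp
      rw [this]
      exact mul_le_of_le_one_left (by positivity) hn
    calc (globalCogrowth φ n : ℝ) ^ (1 / (n : ℝ)) ≤ (σ ^ n) ^ (1 / (n : ℝ)) := by gcongr
      _ = σ := by rw [one_div, Real.pow_rpow_inv_natCast hσ.le hn0]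
  have hle : globalCogrowthRate φ ≤ σ :=
    Filter.limsup_le_of_le
      (Filter.isCoboundedUnder_le_of_le _ (x := 0) fun n => by positivity) hev
  rw [h] at hle
  linarith

theorem wordVal_toList {G : Type*} [Monoid G] (φ : FreeSemigroup X →ₙ* G) (u : FreeSemigroup X) :
    wordVal (fun x => φ (FreeSemigroup.of x)) (u.head :: u.tail) = φ u := by
  induction u using FreeSemigroup.recOnMul with
  | ih1 x => simp [wordVal, FreeSemigroup.of]
  | ih2 x y _ ih => simp [map_mul, ← ih, wordVal]

/-- The global cogrowth is bounded by the correlations of the word vectors in any group image. -/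
theorem globalCogrowth_le [Finite X] {G : Type*} [Group G] (φ : FreeSemigroup X →ₙ* S) (π : S →ₙ* G) (n : ℕ) :
    (globalCogrowth φ n : ℝ) ≤ ∑ i ∈ Finset.range (n + 1),
      inner ℝ (wordVec (fun x => π (φ (FreeSemigroup.of x))) 1 i)
        (wordVec (fun x => π (φ (FreeSemigroup.of x))) 1 (n - i)) := by
  classical
  set g : X → G := fun x => π (φ (FreeSemigroup.of x)) with hg
  let D : ℕ → Finset (List X × List X) := fun i =>
    (words X i ×ˢ words X (n - i)).filter fun q => wordVal g q.1 = wordVal g q.2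
  have hD : ∀ i, inner ℝ (wordVec g 1 i) (wordVec g 1 (n - i)) = ((D i).card : ℝ) := by
    intro i
    rw [inner_wordVec, ← Finset.sum_product', Finset.sum_boole]
    simp only [one_mul, D]
  simp only [hD]
  rw [← Nat.cast_sum]
  -- An upper bound suffices: the splittings with an empty word are harmlessly included.
  refine Nat.cast_le.2 (le_trans ?_ Finset.card_biUnion_le)
  rw [← Nat.card_eq_finsetCard]
  refine Nat.card_le_card_of_injective (fun p => ⟨(p.1.1.head :: p.1.1.tail,
    p.1.2.head :: p.1.2.tail), ?_⟩) ?_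
  · obtain ⟨⟨u, v⟩, hl, hφ⟩ := p
    replace hl := (FreeSemigroup.length_mul u v).symm.trans hl
    simp only [FreeSemigroup.length] at hl
    rw [Finset.mem_biUnion]
    refine ⟨u.tail.length + 1, Finset.mem_range.2 (by omega), ?_⟩
    simp only [D, Finset.mem_filter, Finset.mem_product, mem_words, List.length_cons]
    refine ⟨⟨trivial, by omega⟩, ?_⟩
    have h1 := fun u => wordVal_toList (π.comp φ) u
    exact (h1 u).trans ((congrArg π hφ).trans (h1 v).symm)
  · rintro ⟨⟨⟨a, l⟩, ⟨b, m⟩⟩, h⟩ ⟨⟨⟨a', l'⟩, ⟨b', m'⟩⟩, h'⟩ heq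
    simpa using heq

end Rate

/-! ### Approximate invariance in the group image and its lift. -/

section GroupImage

/-- Averaging over the powers of one generator turns measures that are almost equally translated by
words of the same length into almost invariant ones. -/
theorem approxInvariant_of_not_decay {X G : Type*} [Finite X] [Nonempty X] [Group G] (g : X → G)
    (hdecay : ¬ ∃ ρ C : ℝ, 0 ≤ ρ ∧ ρ < Nat.card X ∧ 0 ≤ C ∧ ∀ n : ℕ,
      ∑ i ∈ Finset.range (n + 1), inner ℝ (wordVec g 1 i) (wordVec g 1 (n - i)) ≤
        C * (n + 1) * ρ ^ n) :
    ApproxInvariant fun (x : X) (h : G) => g x * h := by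
  intro ε hε
  obtain ⟨x₀⟩ := id ‹Nonempty X›
  -- The boundary terms cost `2 * C / N`, at most `ε / 2 * C`; the choice of `ε / 8` below makes `4
  -- * δ` at most `ε / 2`.
  obtain ⟨N, hN⟩ := exists_nat_gt (4 / ε)
  have hN0 : (0 : ℝ) < N := lt_trans (by positivity) hN
  obtain ⟨T, p, hp, hp1, hT⟩ := exists_almost_equally_translated g hdecay N
    (δ := min 1 (ε / 8)) (by positivity) (min_le_left _ _)
  refine ⟨Fin N × T, inferInstance, fun q => p q.2 / N,
    fun q => wordVal g (List.replicate q.1 x₀) * q.2, fun q => div_nonneg (hp _) hN0.le, ?_, ?_⟩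
  · rw [Fintype.sum_prod_type]
    simp only [← Finset.sum_div, Finset.sum_coe_sort T p, hp1, Finset.sum_const, Finset.card_univ,
      Fintype.card_fin, nsmul_eq_mul]
    field_simp
  · intro y F C hF
    have hC : 0 ≤ C := (abs_nonneg _).trans (hF 1)
    let A : List X → ℝ := fun w => ∑ h ∈ T, p h * F (wordVal g w * h)
    let r : ℕ → List X := fun i => List.replicate i x₀
    have hA : ∀ w, |A w| ≤ C := fun w => by
      refine (Finset.abs_sum_le_sum_abs _ _).trans ?_
      calc ∑ h ∈ T, |p h * F (wordVal g w * h)| ≤ ∑ h ∈ T, p h * C := by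
            refine Finset.sum_le_sum fun h _ => ?_
            rw [abs_mul, abs_of_nonneg (hp h)]
            exact mul_le_mul_of_nonneg_left (hF _) (hp h)
        _ = C := by rw [← Finset.sum_mul, hp1, one_mul]
    have hsum : ∀ W : ℕ → List X, ∑ q : Fin N × T, p q.2 / N * F (wordVal g (W q.1) * q.2) =
        (∑ i ∈ Finset.range N, A (W i)) / N := by
      intro W
      rw [Fintype.sum_prod_type, ← Fin.sum_univ_eq_sum_range (fun i => A (W i)), Finset.sum_div]
      refine Finset.sum_congr rfl fun i _ => ?_
      rw [Finset.sum_div, ← Finset.sum_coe_sort T]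
      exact Finset.sum_congr rfl fun _ _ => by ring
    have h1 : ∑ q : Fin N × T, p q.2 / N * F (g y * (wordVal g (r q.1) * q.2)) =
        (∑ i ∈ Finset.range N, A (y :: r i)) / N := by
      rw [← hsum fun i => y :: r i]
      simp only [wordVal, List.map_cons, List.prod_cons, mul_assoc]
    -- Compare `y x₀^i` with `x₀^(i+1)`, which has the same length; what is left telescopes.
    have h2 : ∑ i ∈ Finset.range N, A (y :: r i) - ∑ i ∈ Finset.range N, A (r i) =
        ∑ i ∈ Finset.range N, (A (y :: r i) - A (r (i + 1))) + (A (r N) - A (r 0)) := by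
      rw [← Finset.sum_range_sub (fun i => A (r i)), Finset.sum_sub_distrib,
        Finset.sum_sub_distrib]
      ring
    have h3 : |∑ i ∈ Finset.range N, (A (y :: r i) - A (r (i + 1)))| ≤ N * (ε / 2 * C) := by
      refine (Finset.abs_sum_le_sum_abs _ _).trans ?_
      refine (Finset.sum_le_card_nsmul _ _ (ε / 2 * C) fun i hi => ?_).trans
        (by rw [Finset.card_range, nsmul_eq_mul])
      have hi' := Finset.mem_range.1 hi
      refine (hT (y :: r i) (r (i + 1)) (by simpa [r] using hi') (by simp [r]) F C hF).trans ?_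
      have : min 1 (ε / 8) ≤ ε / 8 := min_le_right _ _
      nlinarith
    have h4 : |A (r N) - A (r 0)| ≤ 2 * C := by
      have hN' := abs_le.1 (hA (r N))
      have h0' := abs_le.1 (hA (r 0))
      exact abs_le.2 ⟨by linarith, by linarith⟩
    have h5 := hsum r
    simp only [r] at h1 h5
    rw [h1, h5, ← sub_div, abs_div, abs_of_pos hN0, div_le_iff₀ hN0]
    change |∑ i ∈ Finset.range N, A (y :: r i) - ∑ i ∈ Finset.range N, A (r i)| ≤ _
    rw [h2]
    refine (abs_add_le _ _).trans ((add_le_add h3 h4).trans ?_)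
    rw [div_lt_iff₀ hε] at hN
    nlinarith

/-- Approximate invariance lifts from the maximal group image. -/
theorem ApproxInvariant.lift {X S : Type*} [Finite X] [Semigroup S] [Nonempty S]
    (hS : IsInverseSemigroup S) (a : X → S)
    (h : ApproxInvariant fun (x : X) (q : MaxGroupImage hS) => (a x : MaxGroupImage hS) * q) :
    ApproxInvariant fun (x : X) (s : S) => a x * s := by
  intro ε hε
  obtain ⟨ι, hι, p, s, hp, hp1, hinv⟩ := h ε hε
  have := Fintype.ofFinite X
  have hout : ∀ q : MaxGroupImage hS, ((Quotient.out q : S) : MaxGroupImage hS) = q := Quotient.out_eq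
  -- Chosen representatives respect multiplication by generators only modulo the congruence; one `e`
  -- corrects all the finitely many discrepancies.
  obtain ⟨e, -, he⟩ := exists_equalising_idempotent hS (Finset.univ : Finset (ι × X))
    (fun q => a q.2 * Quotient.out (s q.1))
    (fun q => Quotient.out ((a q.2 : MaxGroupImage hS) * s q.1)) fun q _ => by
      rw [← Con.eq, Con.coe_mul, hout, hout]
  refine ⟨ι, hι, p, fun i => Quotient.out (s i) * e, hp, hp1, fun x f C hf => ?_⟩
  convert hinv x (fun q => f (Quotient.out q * e)) C (fun _ => hf _) using 6 with i
  rw [← he (i, x) (Finset.mem_univ _), mul_assoc]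

end GroupImage

/-! ### Left and right invariant means on `S`. -/

section Main

variable {X S : Type*} [Finite X] [Semigroup S] [Nonempty S]

theorem approxInvariant_of_hasMaximalGlobalCogrowth (hS : IsInverseSemigroup S)
    {φ : FreeSemigroup X →ₙ* S} (h : HasMaximalGlobalCogrowth φ) :
    ApproxInvariant fun (x : X) (s : S) => φ (FreeSemigroup.of x) * s := by
  rcases isEmpty_or_nonempty X with hX | hX
  · intro ε _
    exact ⟨PUnit, inferInstance, fun _ => 1, fun _ => Classical.arbitrary S, by simp, by simp,
      fun y => isEmptyElim y⟩
  · refine ApproxInvariant.lift hS _ ?_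
    let π : S →ₙ* MaxGroupImage hS := ⟨fun s => s, fun _ _ => rfl⟩
    refine approxInvariant_of_not_decay (fun x => π (φ (FreeSemigroup.of x))) ?_
    rintro ⟨ρ, C, h0, h1, h2, hb⟩
    exact h.not_exists_bound ⟨ρ, C, h0, h1, h2, fun n => (globalCogrowth_le φ π n).trans (hb n)⟩

/-- An inverse semigroup with maximal global cogrowth is amenable; elements that are not
represented by non-empty words are required to be identity elements. -/
theorem amenable_of_hasMaximalGlobalCogrowth (hS : IsInverseSemigroup S)
    {φ : FreeSemigroup X →ₙ* S} (hgen : ∀ a, a ∈ Set.range φ ∨ ∀ b, a * b = b ∧ b * a = b)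
    (h : HasMaximalGlobalCogrowth φ) : Amenable S := by
  have happ := approxInvariant_of_hasMaximalGlobalCogrowth hS h
  constructor
  · obtain ⟨m, hm, hinv⟩ := happ.exists_mean
    refine ⟨m, hm, fun a f => ?_⟩
    rcases hgen a with ⟨u, rfl⟩ | ha
    · induction u using FreeSemigroup.recOnMul generalizing f with
      | ih1 x => exact hinv x f
      | ih2 x y hx hy =>
        refine Eq.trans ?_ ((hy _).trans (hx f))
        congr 1
        ext s
        simp only [LInfty.comp, map_mul, mul_assoc]
    · congr 1
      ext s
      simp only [LInfty.comp, (ha s).1]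
  -- Inversion reverses products, so it carries left translation by a generator to right translation
  -- by its inverse.
  · have happ' : ApproxInvariant
        fun (x : X) (s : S) => s * sinv hS (φ (FreeSemigroup.of x)) := by
      intro ε hε
      obtain ⟨ι, hι, p, s, hp, hp1, hinv⟩ := happ ε hε
      refine ⟨ι, hι, p, fun i => sinv hS (s i), hp, hp1, fun x f C hf => ?_⟩
      simpa only [sinv_mul_rev] using hinv x (fun t => f (sinv hS t)) C fun _ => hf _
    obtain ⟨m, hm, hinv⟩ := happ'.exists_mean
    refine ⟨m, hm, fun a f => ?_⟩
    -- Invariance is known for inverses of generators, so it is `sinv hS a` that has to be written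
    -- as a word.
    rcases hgen (sinv hS a) with ⟨u, hu⟩ | ha
    · rw [← sinv_sinv hS a, ← hu]
      clear hu
      induction u using FreeSemigroup.recOnMul generalizing f with
      | ih1 x => exact hinv x f
      | ih2 x y hx hy =>
        refine Eq.trans ?_ ((hy _).trans (hx f))
        congr 1
        ext s
        simp only [LInfty.comp, map_mul, sinv_mul_rev, mul_assoc]
    · have : sinv hS a = a := by
        rw [← sinv_mul_sinv hS a, (ha a).1, (ha a).2]
      rw [this] at ha
      congr 1
      ext s
      simp only [LInfty.comp, (ha s).2]

theorem amenable_of_restrictNonempty {X M : Type*} [Finite X] [Monoid M] (hM : IsInverseSemigroup M)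
    {ψ : FreeMonoid X →* M} (hψ : Function.Surjective ψ)
    (h : HasMaximalGlobalCogrowth (restrictNonempty ψ)) : Amenable M := by
  refine amenable_of_hasMaximalGlobalCogrowth hM (fun a => ?_) h
  obtain ⟨w, rfl⟩ := hψ a
  induction w using FreeMonoid.inductionOn' with
  | one => exact Or.inr fun b => by simp
  | of_mul x w ih =>
    have hx : restrictNonempty ψ (FreeSemigroup.of x) = ψ (FreeMonoid.of x) := by
      simp [restrictNonempty]
    left
    rcases ih with ⟨u, hu⟩ | hu
    · exact ⟨FreeSemigroup.of x * u, by rw [map_mul, map_mul, hx, hu]⟩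
    · exact ⟨FreeSemigroup.of x, by rw [map_mul, hx, (hu _).2]⟩

end Main

end Cogrowth

theorem mainTheorem8 :
    -- groups, generated as a semigroup
    (∀ (G : Type*) [Group G] (X : Type*) [Finite X] (φ : FreeSemigroup X →ₙ* G),
      Function.Surjective φ → Cogrowth.HasMaximalGlobalCogrowth φ → Cogrowth.Amenable G) ∧
    -- groups, generated as a monoid
    (∀ (G : Type*) [Group G] (X : Type*) [Finite X] (ψ : FreeMonoid X →* G),
      Function.Surjective ψ →
      Cogrowth.HasMaximalGlobalCogrowth (Cogrowth.restrictNonempty ψ) → Cogrowth.Amenable G) ∧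
    -- inverse semigroups, generated as a semigroup
    (∀ (S : Type*) [Semigroup S] [Nonempty S] (X : Type*) [Finite X] (φ : FreeSemigroup X →ₙ* S),
      IsInverseSemigroup S → Function.Surjective φ →
      Cogrowth.HasMaximalGlobalCogrowth φ → Cogrowth.Amenable S) ∧
    -- inverse monoids, generated as a monoid
    (∀ (M : Type*) [Monoid M] (X : Type*) [Finite X] (ψ : FreeMonoid X →* M),
      IsInverseSemigroup M → Function.Surjective ψ →
      Cogrowth.HasMaximalGlobalCogrowth (Cogrowth.restrictNonempty ψ) →
      Cogrowth.Amenable M) := by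
  refine ⟨fun G _ X _ φ hφ h => ?_, fun G _ X _ ψ hψ h => ?_, fun S _ _ X _ φ hS hφ h => ?_,
    fun M _ X _ ψ hM hψ h => ?_⟩
  · exact Cogrowth.amenable_of_hasMaximalGlobalCogrowth (Cogrowth.isInverseSemigroup_of_group G)
      (fun a => Or.inl (hφ a)) h
  · exact Cogrowth.amenable_of_restrictNonempty (Cogrowth.isInverseSemigroup_of_group G) hψ h
  · exact Cogrowth.amenable_of_hasMaximalGlobalCogrowth hS (fun a => Or.inl (hφ a)) h
  · exact Cogrowth.amenable_of_restrictNonempty hM hψ h
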